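/- **Setting.** Let $M=(E,\mathcal I)$ be a matroid on a finite ground set $E$. A *pairwise-independent weight distribution* is a probability distribution $D$ on $\mathbb{R}_{\ge 0}^E$ such that, for $w\sim D$, the weights $w(e)$ and $w(f)$ are independent random variables for any two distinct $e,f\in E$. The *prophet's* reward is $\max\{\sum_{e\in T}w(e) : T\in\mathcal I\}$. Fix an arrival order of $E$. An *online gambler* knows $M$, $D$ and the order, and may use internal randomness independent of $w$; when an element $e$ arrives, the gambler sees $w(e)$ and must irrevocably accept or reject $e$, based only on the internal randomness and the weights seen so far, and the set $S$ of accepted elements must always lie in $\mathcal I$. The gambler's reward is $\sum_{e\in S}w(e)$. For $\alpha \in \mathbb{R}$, we say that $M$ *admits an $\alpha$-competitive pairwise-independent prophet inequality against the oblivious adversary* if for every pairwise-independent weight distribution $D$ with finite expected prophet reward and every arrival order fixed in advance, some online gambler has expected reward at least $\alpha$ times the expected reward of the prophet. For integers $m,n$, let $M_{m}^{\times n}$ be the matroid with ground set $\mathbb{F}_2^{m}\times\{1,\dots,n\}$ in which a set is independent if it contains at most one labeled copy $(v,i)$ of each vector $v\in\mathbb{F}_2^{m}$ and the vectors of which it contains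 a copy are linearly independent (that is, $n$ labeled parallel copies of each element of the full binary matroid of rank $m$). **Theorem.** There is an absolute constant $C>0$ such that the following holds for every integer $\kappa\ge 4$, with $d=2^{2\kappa}$ and $n=\sum_{\ell=1}^{\kappa} d/2^{\ell}$. 1. There are a pairwise-independent weight distribution $D$ and a fixed arrival order on $M_{2d}^{\times n}$ such that the expected reward of the prophet is positive and finite, and every online gambler has expected reward at most $\frac{C}{\log d}$ times the expected reward of the prophet. 2. Consequently, if $M_{2d}^{\times n}$ admits an $\alpha$-competitive pairwise-independent prophet inequality against the oblivious adversary, then $\alpha\le \frac{C}{\log d}$. In particular, there is no $\omega(1/\log \mathrm{Rank})$-competitive pairwise-independent matroid prophet inequality, even against the oblivious adversary: there is no function $\alpha:\mathbb{N}\to\mathbb{R}$ with $\alpha(r)\log r\to\infty$ as $r\to\infty$ such that every finite matroid of rank $r$ admits an $\alpha(r)$-competitive pairwise-independent prophet inequality against the oblivious adversary, for every $r$. -/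

import Mathlib

open MeasureTheory ProbabilityTheory Filter
open scoped NNReal ENNReal

/-- The full linear matroid on a finite vector space `V`: the ground set consists of all vectors,
and the independent sets are the linearly independent sets of vectors. -/
def fullLinearMatroid (F V : Type*) [Field F] [AddCommGroup V] [Module F V] [Finite V] :
    Matroid V :=
  (IndepMatroid.ofFinite (E := Set.univ) Set.finite_univ
    (fun S => LinearIndepOn F id S)
    (linearIndepOn_empty F id)
    (fun _ _ hJ hIJ => LinearIndepOn.mono hJ hIJ)
    (by
      intro I J hI hJ hlt
      by_contra hcon
      push Not at hcon
      have hsub : J ⊆ (Submodule.span F I : Set V) := by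
        intro e he
        by_cases heI : e ∈ I
        · exact Submodule.subset_span heI
        · by_contra hn
          exact hcon e he heI (LinearIndepOn.id_insert hI hn)
      have : Fintype I := Fintype.ofFinite I
      have : Fintype J := Fintype.ofFinite J
      have h1 := finrank_span_set_eq_card hI
      have h2 := finrank_span_set_eq_card hJ
      have h3 : Module.finrank F (Submodule.span F J) ≤ Module.finrank F (Submodule.span F I) :=
        Submodule.finrank_mono (Submodule.span_le.2 hsub)
      rw [h1, h2, ← Set.ncard_eq_toFinset_card', ← Set.ncard_eq_toFinset_card'] at h3
      omega)
    (fun _ _ => Set.subset_univ _)).matroid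

/-- The full binary matroid of rank `m`, on the vector space `𝔽₂ᵐ`. -/
def fullBinaryMatroid (m : ℕ) : Matroid (Fin m → ZMod 2) :=
  fullLinearMatroid (ZMod 2) (Fin m → ZMod 2)

/-- The matroid with `n` labeled parallel copies `(e, 1), …, (e, n)` of each element `e` of `M`:
a set is independent when it contains at most one copy of each element and the set of elements
of which it contains a copy is independent in `M`. -/
def parallelCopies {α : Type*} (M : Matroid α) (n : ℕ) : Matroid (α × Fin n) :=
  M.comap Prod.fst

theorem parallelCopies_indep_iff {α : Type*} (M : Matroid α) (n : ℕ) (T : Set (α × Fin n)) :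
    (parallelCopies M n).Indep T ↔ M.Indep (Prod.fst '' T) ∧ Set.InjOn Prod.fst T :=
  Iff.rfl

section Prophet

variable {E : Type} [Fintype E]

/-- A distribution over nonnegative weight vectors: a probability measure under which the weights
of any two distinct elements are independent random variables. -/
structure IsPairwiseIndependent (D : Measure (E → ℝ≥0)) : Prop where
  isProbabilityMeasure : IsProbabilityMeasure D
  pairwise_indep : ∀ e f : E, e ≠ f →
    IndepFun (fun w : E → ℝ≥0 => w e) (fun w : E → ℝ≥0 => w f) D

/-- The prophet's reward on the weights `w`: the maximum weight of an independent set. -/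
noncomputable def prophetReward (M : Matroid E) (w : E → ℝ≥0) : ℝ≥0∞ :=
  ⨆ T : {T : Finset E // M.Indep (T : Set E)}, ∑ e ∈ T.1, (w e : ℝ≥0∞)

/-- The prophet's expected reward. -/
noncomputable def prophetValue (M : Matroid E) (D : Measure (E → ℝ≥0)) : ℝ≥0∞ :=
  ∫⁻ w, prophetReward M w ∂D

/-- A (possibly randomized) online gambler for the matroid `M`, when the elements arrive in the
order given by `arrival` (the bijection that sends an element to its arrival time).
`Ω` with the law `law` is the gambler's internal randomness, and `select r w` is the set of
elements accepted on internal randomness `r` and weights `w`. It is always independent, and whether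
an element is accepted depends only on the internal randomness and on the weights of the elements
that have arrived so far, including the element itself. -/
structure Gambler (M : Matroid E) (arrival : E ≃ Fin (Fintype.card E)) where
  Ω : Type
  measurableSpace : MeasurableSpace Ω
  law : Measure Ω
  isProbabilityMeasure : IsProbabilityMeasure law
  select : Ω → (E → ℝ≥0) → Finset E
  measurableSet_select : ∀ e : E, MeasurableSet {p : Ω × (E → ℝ≥0) | e ∈ select p.1 p.2}
  indep : ∀ r w, M.Indep (select r w : Set E)
  online : ∀ (r : Ω) (w w' : E → ℝ≥0) (e : E),
    (∀ f, arrival f ≤ arrival e → w f = w' f) → (e ∈ select r w ↔ e ∈ select r w')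

attribute [instance] Gambler.measurableSpace Gambler.isProbabilityMeasure

/-- The gambler's expected reward; the internal randomness is independent of the weights. -/
noncomputable def Gambler.value {M : Matroid E} {arrival : E ≃ Fin (Fintype.card E)}
    (G : Gambler M arrival) (D : Measure (E → ℝ≥0)) : ℝ≥0∞ :=
  ∫⁻ p : G.Ω × (E → ℝ≥0), ∑ e ∈ G.select p.1 p.2, (p.2 e : ℝ≥0∞) ∂(G.law.prod D)

/-- There is an `α`-competitive pairwise-independent prophet inequality for `M` against the
oblivious adversary: for every pairwise-independent weight distribution (with finite expected
prophet reward) and every arrival order fixed in advance, some online gambler, who knows both,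
obtains at least an `α` fraction of the prophet's expected reward. -/
def IsCompetitive (M : Matroid E) (α : ℝ) : Prop :=
  ∀ D : Measure (E → ℝ≥0), IsPairwiseIndependent D → prophetValue M D ≠ ∞ →
    ∀ arrival : E ≃ Fin (Fintype.card E), ∃ G : Gambler M arrival,
      ENNReal.ofReal α * prophetValue M D ≤ G.value D

end Prophet

/-! Pairwise independence cannot tell a random set of large rank from one of small rank. With `N = 2
* d` and inclusion probability `p = 2 ^ j / 2 ^ N`, where `2 ^ j = 8 * d ^ 2`, two random subsets of
an `N`-dimensional binary space have the same one- and two-point probabilities. The fully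
independent one has rank at least `d` with probability at least `1/2`
(`le_lintegral_supportRank_independentSet`). The one obtained by affine hashing into a
`j`-dimensional subspace has expected rank at most `j + 2` (`exists_lowRank_pairwiseRandomSet`),
which is only logarithmic in `d`.

The layers arrive in increasing order, and an active element of layer `i < κ` weighs `2 ^ i`. Layers
up to a geometric time `L` use the high-rank set, later ones the low-rank set. Given `L`, any two
weights have the same joint law, that of two independent variables, so the mixture over `L` is still
pairwise independent (`isPairwiseIndependent_hardDistribution`).

Taking a basis of the active set in layer `L` alone gives the prophet `2 ^ L * d / 2` in
expectation, with probability `2 ^ (-(L + 1))`. Each of the `κ` values `L < κ` thus contributes `d /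
4`, for a total of at least `κ * d / 4`.

The gambler cannot foresee `L`: until the switch, every choice agrees with the one made if no switch
ever occurs. An element so chosen in layer `i` counts only if `L ≥ i`, which has probability `2 ^
(-i)`, and so earns at most `1` on average. Independence limits these choices to the rank `2 * d`.
After the switch, little rank is left, worth at most `2 ^ κ * (j + 2) ≤ 2 * d`
(`tsum_reward_stoppedWeight_le`, `gambler_value_hardDistribution_le`). The ratio `4 * d / (κ * d /
4) = 16 / κ` is of order `1 / log d`. -/

/-! ### Pairwise-independent random sets; low rank by affine hashing -/

/-- The rank of a random set of vectors, given by its indicator function. -/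
noncomputable def supportRank {V : Type} [AddCommGroup V] [Module (ZMod 2) V] (x : V → Bool) : ℕ :=
  Module.finrank (ZMod 2) (Submodule.span (ZMod 2) {v | x v = true})

/-- The law of a random subset of `V` in which every element occurs with probability `p`, and
distinct elements occur independently. -/
structure IsPairwiseRandomSet {V : Type} (p : ℝ≥0∞) (μ : Measure (V → Bool)) : Prop where
  isProbabilityMeasure : IsProbabilityMeasure μ
  single : ∀ v, μ {x | x v = true} = p
  pair : ∀ u v, u ≠ v → μ {x | x u = true ∧ x v = true} = p * p

/-- Affine hashing in a field: `x` occurs when `a * x + b` lies in the additive subgroup `S`. -/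
noncomputable def affineHash {V K : Type} [Field K] [Module (ZMod 2) K]
    (φ : V → K) (S : Submodule (ZMod 2) K) (ab : K × K) (v : V) : Bool :=
  open Classical in decide (ab.1 * φ v + ab.2 ∈ S)

theorem card_affine_mem {K : Type} [Field K] [Fintype K] (S : Set K) (x : K) :
    Nat.card {ab : K × K | ab.1 * x + ab.2 ∈ S} = Nat.card K * Nat.card S := by
  rw [← Nat.card_prod]
  refine Nat.card_congr
    { toFun := fun z => (z.1.1, ⟨z.1.1 * x + z.1.2, z.2⟩)
      invFun := fun z => ⟨(z.1, z.2.1 - z.1 * x), by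
        simp⟩
      left_inv := fun z => by ext <;> simp
      right_inv := fun z => by ext <;> simp }

/-- For distinct `x` and `y`, the values at these two points determine the affine map: `(a, b) ↦ (a
* x + b, a * y + b)` is a bijection of `K × K`. -/
theorem card_affine_mem_pair {K : Type} [Field K] [Fintype K] (S : Set K) {x y : K}
    (h : x ≠ y) :
    Nat.card {ab : K × K | ab.1 * x + ab.2 ∈ S ∧ ab.1 * y + ab.2 ∈ S} =
      Nat.card S * Nat.card S := by
  have hxy : x - y ≠ 0 := sub_ne_zero.2 h
  have hyx : y - x ≠ 0 := sub_ne_zero.2 h.symm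
  rw [← Nat.card_prod]
  refine Nat.card_congr
    { toFun := fun z => (⟨z.1.1 * x + z.1.2, z.2.1⟩, ⟨z.1.1 * y + z.1.2, z.2.2⟩)
      invFun := fun z => ⟨((z.1.1 - z.2.1) / (x - y), z.1.1 - (z.1.1 - z.2.1) / (x - y) * x), by
        have h2 := z.2.2
        constructor
        · simp
        · convert h2 using 1
          field_simp
          ring⟩
      left_inv := fun z => by
        ext
        · simp only
          field_simp
          ring
        · simp only
          field_simp
          ring
      right_inv := fun z => by
        ext
        · simp
        · simp only
          field_simp
          ring }

theorem exists_submodule_finrank_eq {F K : Type} [Field F] [AddCommGroup K] [Module F K]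
    {j : ℕ} (hj : j ≤ Module.finrank F K) :
    ∃ S : Submodule F K, Module.finrank F S = j := by
  obtain ⟨s, hs, hli⟩ := exists_finset_linearIndependent_of_le_finrank hj
  exact ⟨Submodule.span F s, by rw [finrank_span_finset_eq_card hli, hs]⟩

/-- Multiplication by `a ≠ 0` is injective and carries the support into the translate of `S` by `b`,
hence its span into `S ⊔ span {b}`. -/
theorem supportRank_affineHash_le {V K : Type} [AddCommGroup V] [Module (ZMod 2) V] [Finite V]
    [Field K] [Algebra (ZMod 2) K] [Finite K] (φ : V ≃ₗ[ZMod 2] K) (S : Submodule (ZMod 2) K)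
    {ab : K × K} (ha : ab.1 ≠ 0) :
    supportRank (affineHash φ S ab) ≤ Module.finrank (ZMod 2) S + 1 := by
  let ψ : V →ₗ[ZMod 2] K := (LinearMap.mulLeft (ZMod 2) ab.1).comp φ.toLinearMap
  have hψ : Function.Injective ψ := by
    intro u v huv
    have : ab.1 * φ u = ab.1 * φ v := huv
    exact φ.injective (mul_left_cancel₀ ha this)
  have hle : (Submodule.span (ZMod 2) {v | affineHash φ S ab v = true}).map ψ ≤
      S ⊔ Submodule.span (ZMod 2) {ab.2} := by
    rw [Submodule.map_span_le]
    intro v hv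
    have hv' : ab.1 * φ v + ab.2 ∈ S := by simpa [affineHash] using hv
    have : ψ v = (ab.1 * φ v + ab.2) - ab.2 := by simp [ψ]
    rw [this]
    exact Submodule.sub_mem _ (Submodule.mem_sup_left hv')
      (Submodule.mem_sup_right (Submodule.mem_span_singleton_self _))
  calc supportRank (affineHash φ S ab)
      = Module.finrank (ZMod 2)
          ((Submodule.span (ZMod 2) {v | affineHash φ S ab v = true}).map ψ) :=
        (Submodule.equivMapOfInjective ψ hψ _).finrank_eq
    _ ≤ Module.finrank (ZMod 2) (S ⊔ Submodule.span (ZMod 2) {ab.2} : Submodule (ZMod 2) K) :=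
        Submodule.finrank_mono hle
    _ ≤ Module.finrank (ZMod 2) S + Module.finrank (ZMod 2) (Submodule.span (ZMod 2) {ab.2}) :=
        Submodule.finrank_add_le_finrank_add_finrank _ _
    _ ≤ Module.finrank (ZMod 2) S + 1 := by
        gcongr
        exact (finrank_span_le_card _).trans (by simp)

theorem supportRank_le_finrank {V : Type} [AddCommGroup V] [Module (ZMod 2) V] [Finite V]
    (x : V → Bool) : supportRank x ≤ Module.finrank (ZMod 2) V :=
  Submodule.finrank_le _

theorem sum_dirac_apply {ι X : Type} [Fintype ι] [MeasurableSpace X] (c : ℝ≥0∞) (f : ι → X)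
    {A : Set X} (hA : MeasurableSet A) :
    (c • ∑ i, Measure.dirac (f i)) A = c * Nat.card {i | f i ∈ A} := by
  classical
  simp only [Measure.smul_apply, Measure.finsetSum_apply, smul_eq_mul, Measure.dirac_apply' _ hA,
    Set.indicator_apply, Pi.one_apply, Finset.sum_boole, Nat.card_eq_fintype_card,
    Set.coe_ofPred, Fintype.card_subtype]

/-- The pair `(a, b)` is uniform on `K × K`. If `a ≠ 0` the rank is at most `j + 1`. The case `a =
0` has probability `2 ^ (-N)` and adds at most `1` more to the expectation. -/
theorem exists_lowRank_pairwiseRandomSet_of_linearEquiv {V K : Type} [AddCommGroup V]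
    [Module (ZMod 2) V] [Finite V] [Field K] [Algebra (ZMod 2) K] [Finite K]
    (φ : V ≃ₗ[ZMod 2] K) {N j : ℕ} (hK : Module.finrank (ZMod 2) K = N) (hj : j ≤ N) :
    ∃ μ : Measure (V → Bool), IsPairwiseRandomSet ((2 : ℝ≥0∞) ^ j / 2 ^ N) μ ∧
      ∫⁻ x, (supportRank x : ℝ≥0∞) ∂μ ≤ j + 2 := by
  classical
  have : Fintype K := Fintype.ofFinite K
  obtain ⟨S, hS⟩ := exists_submodule_finrank_eq (hj.trans_eq hK.symm)
  have hcK : (Nat.card K : ℝ≥0∞) = 2 ^ N := by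
    rw [Module.natCard_eq_pow_finrank (K := ZMod 2) (V := K), hK]
    simp
  have hcS : (Nat.card (S : Set K) : ℝ≥0∞) = 2 ^ j := by
    change (Nat.card S : ℝ≥0∞) = 2 ^ j
    have := Module.natCard_eq_pow_finrank (K := ZMod 2) (V := S)
    rw [hS] at this
    rw [this]
    simp
  have h0 : (2 : ℝ≥0∞) ^ N ≠ 0 := by simp
  have ht : (2 : ℝ≥0∞) ^ N ≠ ∞ := by simp
  set c : ℝ≥0∞ := ((2 : ℝ≥0∞) ^ N)⁻¹ * (2 ^ N)⁻¹ with hc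
  have hmeas : ∀ A : Set (V → Bool), MeasurableSet A := fun A => A.toFinite.measurableSet
  have hcc : c * (2 ^ N * 2 ^ N) = 1 := by
    rw [hc, mul_mul_mul_comm, ENNReal.inv_mul_cancel h0 ht, one_mul]
  refine ⟨c • ∑ ab : K × K, Measure.dirac (affineHash φ S ab), ⟨⟨?_⟩, ?_, ?_⟩, ?_⟩
  · rw [sum_dirac_apply c _ (hmeas _)]
    simp only [Set.mem_univ, Set.ofPred_true, Nat.card_univ, Nat.card_prod, Nat.cast_mul, hcK, hcc]
  · intro v
    rw [sum_dirac_apply c _ (hmeas _)]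
    have h := card_affine_mem (S : Set K) (φ v)
    simp only [SetLike.mem_coe, Set.coe_ofPred] at h
    simp only [affineHash, Set.mem_ofPred_eq, decide_eq_true_eq, Set.coe_ofPred, h, Nat.cast_mul, hcK]
    rw [hcS, hc, ← mul_assoc, mul_assoc _ _ ((2 : ℝ≥0∞) ^ N), ENNReal.inv_mul_cancel h0 ht,
      mul_one, div_eq_mul_inv, mul_comm]
  · intro u v huv
    rw [sum_dirac_apply c _ (hmeas _)]
    have h := card_affine_mem_pair (S : Set K) (φ.injective.ne huv)
    simp only [SetLike.mem_coe, Set.coe_ofPred] at h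
    simp only [affineHash, Set.mem_ofPred_eq, decide_eq_true_eq, Set.coe_ofPred, h, Nat.cast_mul]
    rw [hcS, hc, div_eq_mul_inv, mul_mul_mul_comm, mul_comm (_⁻¹ * 2 ^ j), mul_comm _ (2 ^ j)]
  · have hV : Module.finrank (ZMod 2) V = N := φ.finrank_eq.trans hK
    -- For `a = 0` the rank is at most `N`; the cruder bound `2 ^ N` exactly cancels the probability
    -- of this case.
    have hbound : ∀ ab : K × K, (supportRank (affineHash φ S ab) : ℝ≥0∞) ≤
        (j + 1) + if ab.1 = 0 then 2 ^ N else 0 := by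
      intro ab
      split_ifs with ha
      · have h1 := supportRank_le_finrank (affineHash φ S ab)
        rw [hV] at h1
        have h2 : supportRank (affineHash φ S ab) ≤ 2 ^ N := h1.trans Nat.lt_two_pow_self.le
        exact le_add_left (by exact_mod_cast h2)
      · have h1 := supportRank_affineHash_le φ S ha
        rw [hS] at h1
        rw [add_zero]
        exact_mod_cast h1
    rw [lintegral_smul_measure, lintegral_finsetSum_measure]
    simp only [lintegral_dirac, smul_eq_mul]
    calc c * ∑ ab : K × K, (supportRank (affineHash φ S ab) : ℝ≥0∞)
        ≤ c * ∑ ab : K × K, (((j : ℝ≥0∞) + 1) + if ab.1 = 0 then 2 ^ N else 0) := by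
          gcongr with ab
          exact hbound ab
      _ = c * (2 ^ N * 2 ^ N) * (j + 2) := by
          have hcard : (Fintype.card K : ℝ≥0∞) = 2 ^ N := by
            rw [← Nat.card_eq_fintype_card, hcK]
          have hz : ∑ ab : K × K, (if ab.1 = 0 then (2 : ℝ≥0∞) ^ N else 0) = 2 ^ N * 2 ^ N := by
            rw [Fintype.sum_prod_type_right]
            simp [hcard]
          rw [Finset.sum_add_distrib, hz, Finset.sum_const, nsmul_eq_mul, Finset.card_univ,
            Fintype.card_prod, Nat.cast_mul, hcard]
          ring
      _ = j + 2 := by rw [hcc, one_mul]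

theorem exists_lowRank_pairwiseRandomSet {V : Type} [AddCommGroup V] [Module (ZMod 2) V]
    [Finite V] {N j : ℕ} (hV : Module.finrank (ZMod 2) V = N) (hN : N ≠ 0) (hj : j ≤ N) :
    ∃ μ : Measure (V → Bool), IsPairwiseRandomSet ((2 : ℝ≥0∞) ^ j / 2 ^ N) μ ∧
      ∫⁻ x, (supportRank x : ℝ≥0∞) ∂μ ≤ j + 2 := by
  have hK : Module.finrank (ZMod 2) (GaloisField 2 N) = N := GaloisField.finrank 2 hN
  exact exists_lowRank_pairwiseRandomSet_of_linearEquiv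
    (LinearEquiv.ofFinrankEq V (GaloisField 2 N) (hV.trans hK.symm)) hK hj

/-! ### Fully independent random sets have large rank -/

/-- The law of a random subset of `V` in which every element occurs independently with
probability `p`. -/
noncomputable def independentSet (V : Type) [Fintype V] (p : ℝ≥0∞) : Measure (V → Bool) :=
  Measure.pi fun _ => p • Measure.dirac true + (1 - p) • Measure.dirac false

theorem isProbabilityMeasure_bernoulli {p : ℝ≥0∞} (hp : p ≤ 1) :
    IsProbabilityMeasure (p • Measure.dirac true + (1 - p) • Measure.dirac false) :=
  ⟨by simp [hp]⟩

theorem isPairwiseRandomSet_independentSet {V : Type} [Fintype V] {p : ℝ≥0∞} (hp : p ≤ 1) :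
    IsPairwiseRandomSet p (independentSet V p) := by
  have := isProbabilityMeasure_bernoulli hp
  have hsingle : ∀ v, independentSet V p {x | x v = true} = p := by
    intro v
    have h := (measurePreserving_eval (fun _ : V =>
      p • Measure.dirac true + (1 - p) • Measure.dirac false) v).measure_preimage
      (MeasurableSet.singleton true).nullMeasurableSet
    refine h.trans ?_
    simp
  refine ⟨by unfold independentSet; infer_instance, hsingle, fun u v huv => ?_⟩
  have h := (iIndepFun_pi (μ := fun _ : V =>
    p • Measure.dirac true + (1 - p) • Measure.dirac false) (X := fun _ b => b)
    (fun _ => aemeasurable_id)).indepFun huv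
  have h2 := h.measure_inter_preimage_eq_mul {true} {true} (MeasurableSet.singleton _)
    (MeasurableSet.singleton _)
  have hu := hsingle u
  have hv := hsingle v
  unfold independentSet at *
  refine h2.trans ?_
  exact congrArg₂ _ hu hv

theorem independentSet_support_subset {V : Type} [Fintype V] {p : ℝ≥0∞} (hp : p ≤ 1)
    (W : Set V) :
    independentSet V p {x | ∀ v, x v = true → v ∈ W} = (1 - p) ^ Nat.card ↑Wᶜ := by
  classical
  have := isProbabilityMeasure_bernoulli hp
  have hset : {x : V → Bool | ∀ v, x v = true → v ∈ W} =
      Set.univ.pi fun v => if v ∈ W then Set.univ else {false} := by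
    ext x
    simp only [Set.mem_ofPred_eq, Set.mem_pi, Set.mem_univ, true_imp_iff]
    refine forall_congr' fun v => ?_
    by_cases hv : v ∈ W <;> simp [hv]
  have hterm : ∀ v, (p • Measure.dirac true + (1 - p) • Measure.dirac false)
      (if v ∈ W then Set.univ else {false}) = if v ∈ W then 1 else 1 - p := by
    intro v
    by_cases hv : v ∈ W
    · simp [hv, hp]
    · simp [hv]
  rw [hset, independentSet, Measure.pi_pi, Finset.prod_congr rfl fun v _ => hterm v,
    Finset.prod_ite]
  simp [Nat.card_eq_fintype_card, Fintype.card_subtype]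

/-- Indexing the possible spans by `d`-tuples, with a basis padded by zeros, leaves only `2 ^ (N *
d)` cases in the union bound below. -/
theorem exists_mem_span_range_of_supportRank_le {V : Type} [AddCommGroup V] [Module (ZMod 2) V]
    [Finite V] {x : V → Bool} {d : ℕ} (h : supportRank x ≤ d) :
    ∃ f : Fin d → V, ∀ v, x v = true → v ∈ Submodule.span (ZMod 2) (Set.range f) := by
  let U := Submodule.span (ZMod 2) {v | x v = true}
  let b : Module.Basis (Fin (supportRank x)) (ZMod 2) U := Module.finBasis (ZMod 2) U
  refine ⟨fun i => if hi : (i : ℕ) < supportRank x then (b ⟨i, hi⟩ : V) else 0, fun v hv => ?_⟩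
  have hv' : v ∈ U := Submodule.subset_span hv
  have hs : (⟨v, hv'⟩ : U) ∈ Submodule.span (ZMod 2) (Set.range b) := by
    rw [b.span_eq]
    exact Submodule.mem_top
  have hm := Submodule.mem_map_of_mem (f := U.subtype) hs
  rw [Submodule.map_span] at hm
  refine Submodule.span_mono ?_ hm
  rintro _ ⟨_, ⟨i, rfl⟩, rfl⟩
  exact ⟨⟨i, i.2.trans_le h⟩, by simp⟩

/-- Here `p * 2 ^ (N - 1) = 2 ^ j / 2 = 4 * d ^ 2`, so the power of `1 - p` is at most `exp (-4 * d
^ 2) ≤ 2 ^ (-4 * d ^ 2)`, which beats the `2 ^ (2 * d ^ 2)` tuples. -/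
theorem one_sub_pow_le {d j N : ℕ} (hj : 2 ^ j = 8 * d ^ 2) (hjN : j ≤ N) (hN : N = 2 * d)
    (hd : 1 ≤ d) :
    (2 : ℝ≥0∞) ^ (N * d) * (1 - 2 ^ j / 2 ^ N) ^ 2 ^ (N - 1) ≤ 2⁻¹ := by
  have hN1 : 1 ≤ N := by omega
  have hp : (2 : ℝ≥0∞) ^ j / 2 ^ N = ENNReal.ofReal (2 ^ j / 2 ^ N) := by
    rw [ENNReal.ofReal_div_of_pos (by positivity), ENNReal.ofReal_pow (by norm_num),
      ENNReal.ofReal_pow (by norm_num)]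
    simp
  have hp1 : (2 : ℝ) ^ j / 2 ^ N ≤ 1 :=
    div_le_one_of_le₀ (pow_le_pow_right₀ (by norm_num) hjN) (by positivity)
  have h2 : (2 : ℝ≥0∞) = ENNReal.ofReal 2 := by simp
  have h2i : (2 : ℝ≥0∞)⁻¹ = ENNReal.ofReal 2⁻¹ := by
    rw [ENNReal.ofReal_inv_of_pos (by norm_num)]
    simp
  rw [hp, ← ENNReal.ofReal_one, ← ENNReal.ofReal_sub _ (by positivity),
    ← ENNReal.ofReal_pow (by linarith), h2i]
  nth_rewrite 1 [h2]
  rw [← ENNReal.ofReal_pow (by norm_num), ← ENNReal.ofReal_mul (by positivity)]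
  apply ENNReal.ofReal_le_ofReal
  have hexp : (1 - (2 : ℝ) ^ j / 2 ^ N) ^ 2 ^ (N - 1) ≤ (1 / 2) ^ (4 * d ^ 2) := by
    calc (1 - (2 : ℝ) ^ j / 2 ^ N) ^ 2 ^ (N - 1)
        ≤ Real.exp (-((2 : ℝ) ^ j / 2 ^ N)) ^ 2 ^ (N - 1) :=
          pow_le_pow_left₀ (by linarith) (Real.one_sub_le_exp_neg _) _
      _ = Real.exp (-1) ^ (4 * d ^ 2) := by
          rw [← Real.exp_nat_mul, ← Real.exp_nat_mul]
          congr 1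
          obtain ⟨K, rfl⟩ : ∃ K, N = K + 1 := ⟨N - 1, by omega⟩
          have hj' : (2 : ℝ) ^ j = 8 * d ^ 2 := by exact_mod_cast hj
          push_cast
          rw [hj', pow_succ (2 : ℝ) K]
          field_simp
          ring
      _ ≤ (1 / 2) ^ (4 * d ^ 2) := by
          refine pow_le_pow_left₀ (Real.exp_pos _).le ?_ _
          rw [Real.exp_neg, one_div]
          exact inv_anti₀ (by norm_num) (by linarith [Real.add_one_le_exp (1 : ℝ)])
  calc (2 : ℝ) ^ (N * d) * (1 - 2 ^ j / 2 ^ N) ^ 2 ^ (N - 1)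
      ≤ 2 ^ (2 * d ^ 2) * (1 / 2) ^ (4 * d ^ 2) := by
        rw [hN, mul_assoc, ← sq, ← hN]
        gcongr
    _ = (1 / 2) ^ (2 * d ^ 2) := by
        rw [show 4 * d ^ 2 = 2 * d ^ 2 + 2 * d ^ 2 by ring, pow_add, ← mul_assoc, ← mul_pow]
        norm_num
    _ ≤ (1 / 2) ^ 1 := pow_le_pow_of_le_one (by norm_num) (by norm_num) (by nlinarith)
    _ = 2⁻¹ := by norm_num

/-- Union bound over the spans of `d`-tuples: since `d ≤ N - 1`, each misses at least half of `V`,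
and all missed vectors must be inactive. -/
theorem independentSet_supportRank_le {V : Type} [AddCommGroup V] [Module (ZMod 2) V]
    [Fintype V] {d j N : ℕ} (hV : Module.finrank (ZMod 2) V = N) (hj : 2 ^ j = 8 * d ^ 2)
    (hjN : j ≤ N) (hN : N = 2 * d) (hd : 1 ≤ d) :
    independentSet V (2 ^ j / 2 ^ N) {x | supportRank x ≤ d} ≤ 2⁻¹ := by
  classical
  have hp : (2 : ℝ≥0∞) ^ j / 2 ^ N ≤ 1 :=
    ENNReal.div_le_of_le_mul (by rw [one_mul]; exact pow_le_pow_right₀ (by norm_num) hjN)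
  have hcV : Nat.card V = 2 ^ N := by
    rw [Module.natCard_eq_pow_finrank (K := ZMod 2) (V := V), hV]
    simp
  have hcompl : ∀ f : Fin d → V,
      2 ^ (N - 1) ≤ Nat.card ((Submodule.span (ZMod 2) (Set.range f) : Set V)ᶜ : Set V) := by
    intro f
    have h1 : Nat.card (Submodule.span (ZMod 2) (Set.range f)) ≤ 2 ^ d := by
      rw [Module.natCard_eq_pow_finrank (K := ZMod 2)]
      simp only [Nat.card_zmod]
      refine pow_le_pow_right₀ (by norm_num) ?_
      simpa [Set.finrank] using finrank_range_le_card (R := ZMod 2) f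
    have h2 := Set.ncard_add_ncard_compl (Submodule.span (ZMod 2) (Set.range f) : Set V)
    rw [hcV] at h2
    change Set.ncard (Submodule.span (ZMod 2) (Set.range f) : Set V) ≤ 2 ^ d at h1
    change _ ≤ Set.ncard _
    have h3 : 2 ^ d ≤ 2 ^ (N - 1) := Nat.pow_le_pow_right (by norm_num) (by omega)
    have h4 : 2 ^ N = 2 ^ (N - 1) + 2 ^ (N - 1) := by
      rw [← two_mul, ← pow_succ']
      congr 1
      omega
    omega
  calc independentSet V (2 ^ j / 2 ^ N) {x | supportRank x ≤ d}
      ≤ independentSet V (2 ^ j / 2 ^ N) (⋃ f : Fin d → V,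
          {x | ∀ v, x v = true → v ∈ (Submodule.span (ZMod 2) (Set.range f) : Set V)}) :=
        measure_mono fun x hx => Set.mem_iUnion.2 (exists_mem_span_range_of_supportRank_le hx)
    _ ≤ ∑ f : Fin d → V, independentSet V (2 ^ j / 2 ^ N)
          {x | ∀ v, x v = true → v ∈ (Submodule.span (ZMod 2) (Set.range f) : Set V)} :=
        measure_iUnion_fintype_le _ _
    _ ≤ ∑ _f : Fin d → V, (1 - (2 : ℝ≥0∞) ^ j / 2 ^ N) ^ 2 ^ (N - 1) := by
        refine Finset.sum_le_sum fun f _ => ?_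
        rw [independentSet_support_subset hp]
        exact pow_le_pow_of_le_one zero_le tsub_le_self (hcompl f)
    _ = 2 ^ (N * d) * (1 - 2 ^ j / 2 ^ N) ^ 2 ^ (N - 1) := by
        rw [Finset.sum_const, nsmul_eq_mul, Finset.card_univ, Fintype.card_fun, Fintype.card_fin,
          ← Nat.card_eq_fintype_card, hcV]
        push_cast
        rw [pow_mul]
    _ ≤ 2⁻¹ := one_sub_pow_le hj hjN hN hd

theorem le_lintegral_supportRank_independentSet {V : Type} [AddCommGroup V] [Module (ZMod 2) V]
    [Fintype V] {d j N : ℕ} (hV : Module.finrank (ZMod 2) V = N) (hj : 2 ^ j = 8 * d ^ 2)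
    (hjN : j ≤ N) (hN : N = 2 * d) (hd : 1 ≤ d) :
    (d : ℝ≥0∞) * 2⁻¹ ≤ ∫⁻ x, (supportRank x : ℝ≥0∞) ∂independentSet V (2 ^ j / 2 ^ N) := by
  have hp : (2 : ℝ≥0∞) ^ j / 2 ^ N ≤ 1 :=
    ENNReal.div_le_of_le_mul (by rw [one_mul]; exact pow_le_pow_right₀ (by norm_num) hjN)
  have := (isPairwiseRandomSet_independentSet (V := V) hp).isProbabilityMeasure
  have hmeas : ∀ A : Set (V → Bool), MeasurableSet A := fun A => A.toFinite.measurableSet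
  have h1 := independentSet_supportRank_le hV hj hjN hN hd
  have h2 : (2 : ℝ≥0∞)⁻¹ ≤
      independentSet V (2 ^ j / 2 ^ N) {x | (d : ℝ≥0∞) ≤ (supportRank x : ℝ≥0∞)} := by
    calc (2 : ℝ≥0∞)⁻¹ = 1 - 2⁻¹ := ENNReal.one_sub_inv_two.symm
      _ ≤ 1 - independentSet V (2 ^ j / 2 ^ N) {x | supportRank x ≤ d} := by gcongr
      _ = independentSet V (2 ^ j / 2 ^ N) {x | supportRank x ≤ d}ᶜ :=
          (prob_compl_eq_one_sub (hmeas _)).symm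
      _ ≤ _ := measure_mono fun x hx => by
          simp only [Set.mem_compl_iff, Set.mem_ofPred_eq, not_le] at hx
          simpa using hx.le
  exact (mul_le_mul_right h2 _).trans (mul_meas_ge_le_lintegral (fun _ _ => hmeas _) _)

/-! ### The mixture over a geometric switching layer, and its pairwise independence -/

section HardDistribution

/-- The set of active vectors in layer `i`: the first random set up to layer `L`, the second one
afterwards. -/
def layerActive {V : Type} {n : ℕ} (L : ℕ) (ω : Fin n → (V → Bool) × (V → Bool)) (i : Fin n) :
    V → Bool :=
  if (i : ℕ) ≤ L then (ω i).1 else (ω i).2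

/-- The weight of the active elements of layer `i`. -/
noncomputable def layerWeight (κ i : ℕ) : ℝ≥0 := if i < κ then 2 ^ i else 0

/-- The weight vector when the random sets switch after layer `L`. -/
noncomputable def stoppedWeight {V : Type} {n : ℕ} (κ L : ℕ)
    (ω : Fin n → (V → Bool) × (V → Bool)) (e : V × Fin n) : ℝ≥0 :=
  if layerActive L ω e.2 e.1 then layerWeight κ e.2 else 0

/-- The law of independent layers, each consisting of a set with law `μ` and one with law `ν`. -/
noncomputable def layersLaw {V : Type} [Fintype V] (n : ℕ) (μ ν : Measure (V → Bool)) :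
    Measure (Fin n → (V → Bool) × (V → Bool)) :=
  Measure.pi fun _ => μ.prod ν

/-- The law of the weights when the last layer `L` of the first kind is geometrically
distributed. -/
noncomputable def hardDistribution {V : Type} [Fintype V] (n κ : ℕ) (μ ν : Measure (V → Bool)) :
    Measure (V × Fin n → ℝ≥0) :=
  Measure.sum fun L : ℕ => (2⁻¹ : ℝ≥0∞) ^ (L + 1) • (layersLaw n μ ν).map (stoppedWeight κ L)

theorem tsum_two_inv_pow_add_one : ∑' L : ℕ, (2⁻¹ : ℝ≥0∞) ^ (L + 1) = 1 := by
  rw [ENNReal.tsum_geometric_add_one, ENNReal.one_sub_inv_two, inv_inv,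
    ENNReal.inv_mul_cancel (by simp) (by simp)]

/-- Layer `i` precedes the switch with probability `2 ^ (-i)`, exactly offsetting the weight `2 ^
i`. -/
theorem tsum_two_inv_pow_tail (i : ℕ) :
    ∑' L : ℕ, (2⁻¹ : ℝ≥0∞) ^ (L + 1) * (if i ≤ L then 2 ^ i else 0) = 1 := by
  rw [← Summable.sum_add_tsum_nat_add' (k := i) ENNReal.summable, Finset.sum_eq_zero, zero_add]
  · rw [← tsum_two_inv_pow_add_one]
    refine tsum_congr fun L => ?_
    rw [if_pos (Nat.le_add_left _ _), show L + i + 1 = (L + 1) + i by ring, pow_add, mul_assoc,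
      ← mul_pow, ENNReal.inv_mul_cancel (by simp) (by simp), one_pow, mul_one]
  · intro L hL
    rw [if_neg (not_le.2 (Finset.mem_range.1 hL)), mul_zero]

theorem indepFun_bool {X : Type} [MeasurableSpace X] {P : Measure X} [IsProbabilityMeasure P]
    {χ ψ : X → Bool} (hχ : Measurable χ) (hψ : Measurable ψ)
    (h : P {x | χ x = true ∧ ψ x = true} = P {x | χ x = true} * P {x | ψ x = true}) :
    IndepFun χ ψ P := by
  have h1 : MeasurableSet {x | χ x = true} := hχ (MeasurableSet.singleton true)
  have h2 : MeasurableSet {x | ψ x = true} := hψ (MeasurableSet.singleton true)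
  have hI : IndepSet {x | χ x = true} {x | ψ x = true} P :=
    (indepSet_iff_measure_inter_eq_mul h1 h2 P).2 h
  have hle : ∀ f : X → Bool, MeasurableSpace.comap f inferInstance ≤
      MeasurableSpace.generateFrom {{x | f x = true}} := by
    intro f
    rw [← measurable_iff_comap_le]
    exact measurable_to_bool (MeasurableSpace.measurableSet_generateFrom rfl)
  exact indep_of_indep_of_le_left (indep_of_indep_of_le_right hI (hle ψ)) (hle χ)

theorem measure_preimage_bool {X : Type} [MeasurableSpace X] {P : Measure X}
    [IsProbabilityMeasure P] {χ : X → Bool} (hχ : Measurable χ) {p : ℝ≥0∞}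
    (h : P {x | χ x = true} = p) (s : Set Bool) :
    P (χ ⁻¹' s) = (p • Measure.dirac true + (1 - p) • Measure.dirac false) s := by
  have h1 : MeasurableSet {x | χ x = true} := hχ (MeasurableSet.singleton true)
  have h2 : P {x | χ x = false} = 1 - p := by
    rw [← h, ← prob_compl_eq_one_sub h1]
    congr 1
    ext x
    simp
  have hmap : P.map χ = p • Measure.dirac true + (1 - p) • Measure.dirac false := by
    refine Measure.ext_of_singleton fun b => ?_
    rw [Measure.map_apply hχ (MeasurableSet.singleton b)]
    cases b
    · exact h2.trans (by simp)
    · exact h.trans (by simp)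
  rw [← hmap, Measure.map_apply hχ (MeasurableSet.of_discrete)]

variable {V : Type} [Fintype V] {n : ℕ} {μ ν : Measure (V → Bool)} {p : ℝ≥0∞}

theorem isProbabilityMeasure_layersLaw [IsProbabilityMeasure μ] [IsProbabilityMeasure ν] :
    IsProbabilityMeasure (layersLaw n μ ν) := by
  unfold layersLaw
  infer_instance

theorem measurePreserving_layer_fst [IsProbabilityMeasure μ] [IsProbabilityMeasure ν]
    (i : Fin n) : MeasurePreserving (fun ω => (ω i).1) (layersLaw n μ ν) μ :=
  measurePreserving_fst.comp (measurePreserving_eval (fun _ => μ.prod ν) i)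

theorem measurePreserving_layer_snd [IsProbabilityMeasure μ] [IsProbabilityMeasure ν]
    (i : Fin n) : MeasurePreserving (fun ω => (ω i).2) (layersLaw n μ ν) ν :=
  measurePreserving_snd.comp (measurePreserving_eval (fun _ => μ.prod ν) i)

theorem layersLaw_layerActive (hμ : IsPairwiseRandomSet p μ) (hν : IsPairwiseRandomSet p ν)
    (L : ℕ) (e : V × Fin n) :
    layersLaw n μ ν {ω | layerActive L ω e.2 e.1 = true} = p := by
  have := hμ.isProbabilityMeasure
  have := hν.isProbabilityMeasure
  unfold layerActive
  by_cases h : (e.2 : ℕ) ≤ L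
  · simp only [h, if_true]
    rw [← hμ.single e.1]
    exact (measurePreserving_layer_fst e.2).measure_preimage
      (MeasurableSet.of_discrete (s := {x : V → Bool | x e.1 = true})).nullMeasurableSet
  · simp only [h, if_false]
    rw [← hν.single e.1]
    exact (measurePreserving_layer_snd e.2).measure_preimage
      (MeasurableSet.of_discrete (s := {x : V → Bool | x e.1 = true})).nullMeasurableSet

/-- Within one layer this is the pair condition of `μ` or `ν`; distinct layers are independent. -/
theorem layersLaw_layerActive_pair (hμ : IsPairwiseRandomSet p μ)
    (hν : IsPairwiseRandomSet p ν) (L : ℕ) {e f : V × Fin n} (hef : e ≠ f) :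
    layersLaw n μ ν {ω | layerActive L ω e.2 e.1 = true ∧ layerActive L ω f.2 f.1 = true} =
      p * p := by
  have := hμ.isProbabilityMeasure
  have := hν.isProbabilityMeasure
  obtain ⟨u, i⟩ := e
  obtain ⟨v, k⟩ := f
  by_cases hik : i = k
  · subst hik
    have huv : u ≠ v := fun h => hef (by rw [h])
    unfold layerActive
    by_cases h : (i : ℕ) ≤ L
    · simp only [h, if_true]
      rw [← hμ.pair u v huv]
      exact (measurePreserving_layer_fst i).measure_preimage
        (MeasurableSet.of_discrete
          (s := {x : V → Bool | x u = true ∧ x v = true})).nullMeasurableSet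
    · simp only [h, if_false]
      rw [← hν.pair u v huv]
      exact (measurePreserving_layer_snd i).measure_preimage
        (MeasurableSet.of_discrete
          (s := {x : V → Bool | x u = true ∧ x v = true})).nullMeasurableSet
  · have h := (iIndepFun_pi (μ := fun _ : Fin n => μ.prod ν)
      (X := fun i z => if (i : ℕ) ≤ L then z.1 else z.2)
      (fun i => Measurable.of_discrete.aemeasurable)).indepFun hik
    have h2 := h.measure_inter_preimage_eq_mul {x | x u = true} {x | x v = true}
      MeasurableSet.of_discrete MeasurableSet.of_discrete
    have h3 := layersLaw_layerActive hμ hν L (u, i)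
    have h4 := layersLaw_layerActive hμ hν L (v, k)
    exact h2.trans (congrArg₂ _ h3 h4)

theorem lintegral_hardDistribution (κ : ℕ) {g : (V × Fin n → ℝ≥0) → ℝ≥0∞} (hg : Measurable g) :
    ∫⁻ w, g w ∂hardDistribution n κ μ ν =
      ∑' L : ℕ, (2⁻¹ : ℝ≥0∞) ^ (L + 1) * ∫⁻ ω, g (stoppedWeight κ L ω) ∂layersLaw n μ ν := by
  rw [hardDistribution, lintegral_sum_measure]
  refine tsum_congr fun L => ?_
  rw [lintegral_smul_measure, lintegral_map hg Measurable.of_discrete, smul_eq_mul]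

theorem hardDistribution_apply (κ : ℕ) {A : Set (V × Fin n → ℝ≥0)} (hA : MeasurableSet A) :
    hardDistribution n κ μ ν A =
      ∑' L : ℕ, (2⁻¹ : ℝ≥0∞) ^ (L + 1) * layersLaw n μ ν (stoppedWeight κ L ⁻¹' A) := by
  rw [hardDistribution, Measure.sum_apply _ hA]
  refine tsum_congr fun L => ?_
  rw [Measure.smul_apply, Measure.map_apply Measurable.of_discrete hA, smul_eq_mul]

/-- A mixture of pairwise-independent laws need not be pairwise independent. Here it is, because the
marginals, expressed through the Bernoulli law `β`, do not depend on `L`. -/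
theorem isPairwiseIndependent_hardDistribution (κ : ℕ) (hμ : IsPairwiseRandomSet p μ)
    (hν : IsPairwiseRandomSet p ν) :
    IsPairwiseIndependent (hardDistribution n κ μ ν) := by
  have := hμ.isProbabilityMeasure
  have := hν.isProbabilityMeasure
  have hP : IsProbabilityMeasure (layersLaw n μ ν) := isProbabilityMeasure_layersLaw
  let β : Measure Bool := p • Measure.dirac true + (1 - p) • Measure.dirac false
  let g : V × Fin n → Bool → ℝ≥0 := fun e b => if b then layerWeight κ e.2 else 0
  have hsingle : ∀ (L : ℕ) (e : V × Fin n) (s : Set ℝ≥0),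
      layersLaw n μ ν {ω | stoppedWeight κ L ω e ∈ s} = β (g e ⁻¹' s) := fun L e s =>
    measure_preimage_bool (χ := fun ω => layerActive L ω e.2 e.1) Measurable.of_discrete
      (layersLaw_layerActive hμ hν L e) (g e ⁻¹' s)
  have hpair : ∀ (L : ℕ) (e f : V × Fin n) (s t : Set ℝ≥0), e ≠ f →
      layersLaw n μ ν {ω | stoppedWeight κ L ω e ∈ s ∧ stoppedWeight κ L ω f ∈ t} =
        β (g e ⁻¹' s) * β (g f ⁻¹' t) := by
    intro L e f s t hef
    have hI : IndepFun (fun ω => layerActive L ω e.2 e.1) (fun ω => layerActive L ω f.2 f.1)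
        (layersLaw n μ ν) := by
      refine indepFun_bool Measurable.of_discrete Measurable.of_discrete ?_
      rw [layersLaw_layerActive_pair hμ hν L hef, layersLaw_layerActive hμ hν L e,
        layersLaw_layerActive hμ hν L f]
    rw [← hsingle L e s, ← hsingle L f t]
    exact hI.measure_inter_preimage_eq_mul (g e ⁻¹' s) (g f ⁻¹' t) MeasurableSet.of_discrete
      MeasurableSet.of_discrete
  have hD1 : ∀ (e : V × Fin n) (s : Set ℝ≥0), MeasurableSet s →
      hardDistribution n κ μ ν ((fun w => w e) ⁻¹' s) = β (g e ⁻¹' s) := by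
    intro e s hs
    have h : ∀ L, layersLaw n μ ν (stoppedWeight κ L ⁻¹' ((fun w => w e) ⁻¹' s)) =
        β (g e ⁻¹' s) := fun L => hsingle L e s
    simp_rw [hardDistribution_apply κ (measurable_pi_apply e hs), h]
    rw [ENNReal.tsum_mul_right,
      tsum_two_inv_pow_add_one, one_mul]
  refine ⟨⟨?_⟩, fun e f hef => ?_⟩
  · rw [hardDistribution_apply κ MeasurableSet.univ]
    simp [tsum_two_inv_pow_add_one]
  · rw [indepFun_iff_measure_inter_preimage_eq_mul]
    intro s t hs ht
    have h : ∀ L, layersLaw n μ ν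
        (stoppedWeight κ L ⁻¹' ((fun w => w e) ⁻¹' s ∩ (fun w => w f) ⁻¹' t)) =
        β (g e ⁻¹' s) * β (g f ⁻¹' t) := fun L => hpair L e f s t hef
    simp_rw [hD1 e s hs, hD1 f t ht,
      hardDistribution_apply κ ((measurable_pi_apply e hs).inter (measurable_pi_apply f ht)), h]
    rw [ENNReal.tsum_mul_right,
      tsum_two_inv_pow_add_one, one_mul]

end HardDistribution

/-! ### The prophet: finiteness and lower bound -/

theorem stoppedWeight_le {V : Type} {n : ℕ} (κ L : ℕ) (ω : Fin n → (V → Bool) × (V → Bool)) (e : V × Fin n) :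
    stoppedWeight κ L ω e ≤ layerWeight κ e.2 := by
  unfold stoppedWeight
  split_ifs
  · exact le_rfl
  · exact zero_le

theorem measurable_prophetReward {E : Type} [Fintype E] (M : Matroid E) :
    Measurable (prophetReward M) :=
  Measurable.iSup fun _ => Finset.measurable_fun_sum _ fun e _ =>
    (measurable_pi_apply e).coe_nnreal_ennreal

theorem prophetReward_le_sum {E : Type} [Fintype E] (M : Matroid E) (w : E → ℝ≥0) :
    prophetReward M w ≤ ∑ e, (w e : ℝ≥0∞) :=
  iSup_le fun T => Finset.sum_le_sum_of_subset (Finset.subset_univ T.1)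

theorem prophetValue_hardDistribution_lt_top {V : Type} [Fintype V] {n : ℕ}
    {μ ν : Measure (V → Bool)} [IsProbabilityMeasure μ] [IsProbabilityMeasure ν]
    (M : Matroid (V × Fin n)) (κ : ℕ) :
    prophetValue M (hardDistribution n κ μ ν) < ∞ := by
  have hP : IsProbabilityMeasure (layersLaw n μ ν) := isProbabilityMeasure_layersLaw
  rw [prophetValue, lintegral_hardDistribution κ (measurable_prophetReward M)]
  calc ∑' L : ℕ, (2⁻¹ : ℝ≥0∞) ^ (L + 1) *
        ∫⁻ ω, prophetReward M (stoppedWeight κ L ω) ∂layersLaw n μ ν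
      ≤ ∑' L : ℕ, (2⁻¹ : ℝ≥0∞) ^ (L + 1) *
          ∫⁻ _ω, ∑ e : V × Fin n, (layerWeight κ e.2 : ℝ≥0∞) ∂layersLaw n μ ν := by
        gcongr with L ω
        refine (prophetReward_le_sum M _).trans (Finset.sum_le_sum fun e _ => ?_)
        exact_mod_cast stoppedWeight_le κ L ω e
    _ = ∑ e : V × Fin n, (layerWeight κ e.2 : ℝ≥0∞) := by
        rw [ENNReal.tsum_mul_right, tsum_two_inv_pow_add_one, one_mul, lintegral_const,
          measure_univ, mul_one]
    _ < ∞ := ENNReal.sum_lt_top.2 fun e _ => ENNReal.coe_lt_top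

section ParallelCopies

variable {V : Type} [AddCommGroup V] [Module (ZMod 2) V] [Fintype V] {n : ℕ}

theorem parallelCopies_fullLinearMatroid_indep_iff (T : Set (V × Fin n)) :
    (parallelCopies (fullLinearMatroid (ZMod 2) V) n).Indep T ↔
      LinearIndepOn (ZMod 2) id (Prod.fst '' T) ∧ Set.InjOn Prod.fst T :=
  Iff.rfl

theorem card_le_supportRank {S : Finset (V × Fin n)} {x : V → Bool}
    (hS : (parallelCopies (fullLinearMatroid (ZMod 2) V) n).Indep (S : Set (V × Fin n)))
    (hx : ∀ e ∈ S, x e.1 = true) : S.card ≤ supportRank x := by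
  classical
  obtain ⟨hli, hinj⟩ := (parallelCopies_fullLinearMatroid_indep_iff _).1 hS
  rw [← Finset.coe_image] at hli
  have hcard : Module.finrank (ZMod 2)
      (Submodule.span (ZMod 2) (S.image Prod.fst : Set V)) = S.card :=
    (finrank_span_finset_eq_card hli).trans (Finset.card_image_of_injOn hinj)
  rw [← hcard]
  refine Submodule.finrank_mono (Submodule.span_mono fun v hv => ?_)
  obtain ⟨e, he, rfl⟩ := Finset.mem_image.1 (Finset.mem_coe.1 hv)
  exact hx e he

theorem card_le_finrank_of_indep {S : Finset (V × Fin n)}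
    (hS : (parallelCopies (fullLinearMatroid (ZMod 2) V) n).Indep (S : Set (V × Fin n))) :
    S.card ≤ Module.finrank (ZMod 2) V :=
  (card_le_supportRank (x := fun _ => true) hS fun _ _ => rfl).trans (supportRank_le_finrank _)

theorem exists_indep_card_eq_supportRank (x : V → Bool) (i : Fin n) :
    ∃ T : Finset (V × Fin n),
      (parallelCopies (fullLinearMatroid (ZMod 2) V) n).Indep (T : Set (V × Fin n)) ∧
      T.card = supportRank x ∧ ∀ e ∈ T, e.2 = i ∧ x e.1 = true := by
  classical
  obtain ⟨b, hbx, hspan, hli⟩ := exists_linearIndependent (ZMod 2) {v | x v = true}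
  have hinj : Function.Injective fun v : V => (v, i) := fun u v h => congrArg Prod.fst h
  have hb : b.toFinset.card = supportRank x := by
    rw [supportRank, ← hspan]
    exact (finrank_span_set_eq_card hli).symm
  refine ⟨b.toFinset.map ⟨_, hinj⟩, ?_, by rw [Finset.card_map, hb], ?_⟩
  · rw [parallelCopies_fullLinearMatroid_indep_iff]
    constructor
    · have : Prod.fst '' ((b.toFinset.map ⟨_, hinj⟩ : Finset (V × Fin n)) : Set (V × Fin n)) =
          b := by
        ext v
        simp
      rw [this]
      exact hli
    · intro e he f hf hef
      simp only [Finset.coe_map, Function.Embedding.coeFn_mk, Set.mem_image] at he hf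
      obtain ⟨u, -, rfl⟩ := he
      obtain ⟨v, -, rfl⟩ := hf
      exact congrArg (·, i) hef
  · intro e he
    obtain ⟨v, hv, rfl⟩ := Finset.mem_map.1 he
    exact ⟨rfl, hbx (Set.mem_toFinset.1 hv)⟩

theorem eRank_parallelCopies_fullLinearMatroid (hn : 0 < n) :
    (parallelCopies (fullLinearMatroid (ZMod 2) V) n).eRank = Module.finrank (ZMod 2) V := by
  classical
  apply le_antisymm
  · obtain ⟨B, hB⟩ := (parallelCopies (fullLinearMatroid (ZMod 2) V) n).exists_isBase
    rw [← hB.encard_eq_eRank, ← B.toFinite.coe_toFinset, Set.encard_coe_eq_coe_finsetCard]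
    have hI : (parallelCopies (fullLinearMatroid (ZMod 2) V) n).Indep
        (B.toFinite.toFinset : Set (V × Fin n)) := by
      rw [B.toFinite.coe_toFinset]
      exact hB.indep
    exact_mod_cast card_le_finrank_of_indep hI
  · obtain ⟨T, hT, hcard, -⟩ := exists_indep_card_eq_supportRank (fun _ : V => true) ⟨0, hn⟩
    have h := hT.encard_le_eRank
    rw [Set.encard_coe_eq_coe_finsetCard, hcard] at h
    have hs : {v : V | (fun _ => true : V → Bool) v = true} = Set.univ := by
      ext
      simp
    rwa [supportRank, hs, Submodule.span_univ, finrank_top] at h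

variable {μ ν : Measure (V → Bool)}

theorem le_prophetReward_stoppedWeight {κ : ℕ} (i : Fin n) (hi : (i : ℕ) < κ)
    (ω : Fin n → (V → Bool) × (V → Bool)) :
    (2 : ℝ≥0∞) ^ (i : ℕ) * supportRank (ω i).1 ≤
      prophetReward (parallelCopies (fullLinearMatroid (ZMod 2) V) n) (stoppedWeight κ i ω) := by
  obtain ⟨T, hT, hcard, hTx⟩ := exists_indep_card_eq_supportRank (ω i).1 i
  refine le_trans (le_of_eq ?_) (le_iSup (fun T : {T : Finset (V × Fin n) //
    (parallelCopies (fullLinearMatroid (ZMod 2) V) n).Indep (T : Set (V × Fin n))} =>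
      ∑ e ∈ T.1, (stoppedWeight κ i ω e : ℝ≥0∞)) ⟨T, hT⟩)
  rw [Finset.sum_congr rfl (g := fun _ => (2 : ℝ≥0∞) ^ (i : ℕ)), Finset.sum_const, hcard,
    nsmul_eq_mul, mul_comm]
  intro e he
  obtain ⟨h2, h1⟩ := hTx e he
  simp [stoppedWeight, layerActive, layerWeight, h2, h1, hi]

/-- For each `L < κ`, layer `L` alone yields `2 ^ L` times its rank, and the probability `2 ^ (-(L +
1))` leaves half the expected rank. -/
theorem le_prophetValue_hardDistribution [IsProbabilityMeasure μ] [IsProbabilityMeasure ν]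
    {κ : ℕ} (hκ : κ ≤ n) :
    (κ : ℝ≥0∞) * (2⁻¹ * ∫⁻ x, (supportRank x : ℝ≥0∞) ∂μ) ≤
      prophetValue (parallelCopies (fullLinearMatroid (ZMod 2) V) n)
        (hardDistribution n κ μ ν) := by
  rw [prophetValue, lintegral_hardDistribution κ (measurable_prophetReward _)]
  refine le_trans ?_ (ENNReal.sum_le_tsum (Finset.range κ))
  rw [← nsmul_eq_mul]
  conv_lhs => rw [← Finset.card_range κ]
  refine Finset.card_nsmul_le_sum _ _ _ fun L hL => ?_
  have hLκ := Finset.mem_range.1 hL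
  let i : Fin n := ⟨L, hLκ.trans_le hκ⟩
  calc 2⁻¹ * ∫⁻ x, (supportRank x : ℝ≥0∞) ∂μ
      = (2⁻¹ : ℝ≥0∞) ^ (L + 1) * ∫⁻ ω, 2 ^ L * supportRank (ω i).1 ∂layersLaw n μ ν := by
        rw [lintegral_const_mul _ Measurable.of_discrete,
          (measurePreserving_layer_fst i).lintegral_comp
            (f := fun x : V → Bool => (supportRank x : ℝ≥0∞)) Measurable.of_discrete, ← mul_assoc,
          pow_succ, mul_assoc _ _ (2 ^ L), mul_comm 2⁻¹ (2 ^ L), ← mul_assoc, ← mul_pow,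
          ENNReal.inv_mul_cancel (by simp) (by simp), one_pow, one_mul]
    _ ≤ _ := by
        gcongr with ω
        exact le_prophetReward_stoppedWeight i hLκ ω

end ParallelCopies

/-! ### The gambler: upper bound -/

section Gambler

variable {V : Type} [AddCommGroup V] [Module (ZMod 2) V] [Fintype V] {n : ℕ}
  {arrival : V × Fin n ≃ Fin (Fintype.card (V × Fin n))}

/-- The reward from elements in layers after `L`. -/
theorem sum_late_stoppedWeight_le {κ L : ℕ} {S : Finset (V × Fin n)}
    (hS : (parallelCopies (fullLinearMatroid (ZMod 2) V) n).Indep (S : Set (V × Fin n)))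
    (ω : Fin n → (V → Bool) × (V → Bool)) :
    ∑ e ∈ S with ¬ (e.2 : ℕ) ≤ L, (stoppedWeight κ L ω e : ℝ≥0∞) ≤
      ∑ i : Fin n, (layerWeight κ i : ℝ≥0∞) * supportRank (ω i).2 := by
  classical
  rw [← Finset.sum_fiberwise _ (fun e : V × Fin n => e.2)]
  refine Finset.sum_le_sum fun i _ => ?_
  rw [← Finset.sum_filter_add_sum_filter_not _ (fun e => (ω i).2 e.1 = true)]
  have h0 : ∑ e ∈ ((S.filter fun e => ¬ (e.2 : ℕ) ≤ L).filter fun e => e.2 = i) with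
      ¬ (ω i).2 e.1 = true, (stoppedWeight κ L ω e : ℝ≥0∞) = 0 := by
    refine Finset.sum_eq_zero fun e he => ?_
    simp only [Finset.mem_filter] at he
    obtain ⟨⟨⟨-, hL⟩, rfl⟩, hx⟩ := he
    simp [stoppedWeight, layerActive, hL, hx]
  rw [h0, add_zero, mul_comm, ← nsmul_eq_mul]
  set T := (((S.filter fun e => ¬ (e.2 : ℕ) ≤ L).filter fun e => e.2 = i).filter
    fun e => (ω i).2 e.1 = true) with hT
  have hTS : T ⊆ S := (Finset.filter_subset _ _).trans
    ((Finset.filter_subset _ _).trans (Finset.filter_subset _ _))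
  have hcard : T.card ≤ supportRank (ω i).2 :=
    card_le_supportRank (hS.subset (Finset.coe_subset.2 hTS)) fun e he => (Finset.mem_filter.1 he).2
  calc ∑ e ∈ T, (stoppedWeight κ L ω e : ℝ≥0∞) ≤ T.card • (layerWeight κ i : ℝ≥0∞) := by
        refine Finset.sum_le_card_nsmul _ _ _ fun e he => ?_
        have h2 : e.2 = i := (Finset.mem_filter.1 (Finset.mem_filter.1 he).1).2
        rw [← h2]
        exact_mod_cast stoppedWeight_le κ L ω e
    _ ≤ supportRank (ω i).2 • (layerWeight κ i : ℝ≥0∞) := by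
        rw [nsmul_eq_mul, nsmul_eq_mul]
        gcongr

/-- All values of `L` are coupled through the same `ω`. Switching after layer `n` means never
switching, and up to layer `L` the two weight vectors agree. -/
theorem mem_select_stoppedWeight_iff
    (G : Gambler (parallelCopies (fullLinearMatroid (ZMod 2) V) n) arrival)
    (hmono : ∀ e f : V × Fin n, arrival f ≤ arrival e → f.2 ≤ e.2) (r : G.Ω) (κ L : ℕ)
    (ω : Fin n → (V → Bool) × (V → Bool)) {e : V × Fin n} (he : (e.2 : ℕ) ≤ L) :
    e ∈ G.select r (stoppedWeight κ L ω) ↔ e ∈ G.select r (stoppedWeight κ n ω) := by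
  refine G.online r _ _ e fun f hf => ?_
  have h1 : (f.2 : ℕ) ≤ L := le_trans (hmono e f hf) he
  have h2 : (f.2 : ℕ) ≤ n := f.2.2.le
  simp [stoppedWeight, layerActive, h1, h2]

/-- For fixed `r` and `ω`, one set `S`, the selection without a switch, governs the early reward for
every `L`. Averaging over `L` makes each of its elements worth at most `1`, and `S` is independent.
-/
theorem tsum_reward_stoppedWeight_le
    (G : Gambler (parallelCopies (fullLinearMatroid (ZMod 2) V) n) arrival)
    (hmono : ∀ e f : V × Fin n, arrival f ≤ arrival e → f.2 ≤ e.2) (r : G.Ω) (κ : ℕ)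
    (ω : Fin n → (V → Bool) × (V → Bool)) :
    ∑' L : ℕ, (2⁻¹ : ℝ≥0∞) ^ (L + 1) *
        ∑ e ∈ G.select r (stoppedWeight κ L ω), (stoppedWeight κ L ω e : ℝ≥0∞) ≤
      Module.finrank (ZMod 2) V +
        ∑ i : Fin n, (layerWeight κ i : ℝ≥0∞) * supportRank (ω i).2 := by
  classical
  set S := G.select r (stoppedWeight κ n ω) with hS
  set B := ∑ i : Fin n, (layerWeight κ i : ℝ≥0∞) * supportRank (ω i).2 with hB
  have hL : ∀ L : ℕ, ∑ e ∈ G.select r (stoppedWeight κ L ω), (stoppedWeight κ L ω e : ℝ≥0∞) ≤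
      (∑ e ∈ S, if (e.2 : ℕ) ≤ L then (2 : ℝ≥0∞) ^ (e.2 : ℕ) else 0) + B := by
    intro L
    rw [← Finset.sum_filter_add_sum_filter_not _ (fun e => (e.2 : ℕ) ≤ L)]
    refine add_le_add ?_ (sum_late_stoppedWeight_le (G.indep r _) ω)
    have hset : (G.select r (stoppedWeight κ L ω)).filter (fun e => (e.2 : ℕ) ≤ L) =
        S.filter (fun e => (e.2 : ℕ) ≤ L) := by
      ext e
      simp only [Finset.mem_filter]
      exact and_congr_left fun he => mem_select_stoppedWeight_iff G hmono r κ L ω he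
    rw [hset, ← Finset.sum_filter]
    refine Finset.sum_le_sum fun e _ => ?_
    have h1 := stoppedWeight_le κ L ω e
    have h2 : layerWeight κ e.2 ≤ 2 ^ (e.2 : ℕ) := by
      unfold layerWeight
      split_ifs
      · exact le_rfl
      · exact zero_le
    exact_mod_cast h1.trans h2
  calc ∑' L : ℕ, (2⁻¹ : ℝ≥0∞) ^ (L + 1) *
        ∑ e ∈ G.select r (stoppedWeight κ L ω), (stoppedWeight κ L ω e : ℝ≥0∞)
      ≤ ∑' L : ℕ, (2⁻¹ : ℝ≥0∞) ^ (L + 1) *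
          ((∑ e ∈ S, if (e.2 : ℕ) ≤ L then (2 : ℝ≥0∞) ^ (e.2 : ℕ) else 0) + B) := by
        gcongr with L
        exact hL L
    _ = (∑ e ∈ S, ∑' L : ℕ, (2⁻¹ : ℝ≥0∞) ^ (L + 1) *
          (if (e.2 : ℕ) ≤ L then (2 : ℝ≥0∞) ^ (e.2 : ℕ) else 0)) + B := by
        simp_rw [mul_add, Finset.mul_sum]
        rw [ENNReal.tsum_add, ENNReal.tsum_mul_right, tsum_two_inv_pow_add_one, one_mul,
          Summable.tsum_finsetSum fun _ _ => ENNReal.summable]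
    _ = S.card + B := by
        simp_rw [tsum_two_inv_pow_tail]
        simp
    _ ≤ Module.finrank (ZMod 2) V + B := by
        gcongr
        exact card_le_finrank_of_indep (G.indep r _)

theorem measurable_reward {E : Type} [Fintype E] {M : Matroid E}
    {arrival : E ≃ Fin (Fintype.card E)} (G : Gambler M arrival) :
    Measurable fun p : G.Ω × (E → ℝ≥0) => ∑ e ∈ G.select p.1 p.2, (p.2 e : ℝ≥0∞) := by
  classical
  have h : (fun p : G.Ω × (E → ℝ≥0) => ∑ e ∈ G.select p.1 p.2, (p.2 e : ℝ≥0∞)) =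
      fun p => ∑ e, {p : G.Ω × (E → ℝ≥0) | e ∈ G.select p.1 p.2}.indicator
        (fun p => (p.2 e : ℝ≥0∞)) p := by
    ext p
    simp [Set.indicator_apply, Finset.sum_ite_mem]
  rw [h]
  exact Finset.measurable_fun_sum _ fun e _ =>
    ((measurable_pi_apply e).comp measurable_snd).coe_nnreal_ennreal.indicator
      (G.measurableSet_select e)

theorem gambler_value_hardDistribution_le {μ ν : Measure (V → Bool)} [IsProbabilityMeasure μ]
    [IsProbabilityMeasure ν] (κ : ℕ) [IsProbabilityMeasure (hardDistribution n κ μ ν)]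
    (G : Gambler (parallelCopies (fullLinearMatroid (ZMod 2) V) n) arrival)
    (hmono : ∀ e f : V × Fin n, arrival f ≤ arrival e → f.2 ≤ e.2) :
    G.value (hardDistribution n κ μ ν) ≤ Module.finrank (ZMod 2) V +
      2 ^ κ * ∫⁻ x, (supportRank x : ℝ≥0∞) ∂ν := by
  have hP : IsProbabilityMeasure (layersLaw n μ ν) := isProbabilityMeasure_layersLaw
  have hmeas := measurable_reward G
  rw [Gambler.value, lintegral_prod _ hmeas.aemeasurable]
  have hr : ∀ r : G.Ω, ∫⁻ w, ∑ e ∈ G.select r w, (w e : ℝ≥0∞) ∂hardDistribution n κ μ ν ≤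
      Module.finrank (ZMod 2) V + 2 ^ κ * ∫⁻ x, (supportRank x : ℝ≥0∞) ∂ν := by
    intro r
    rw [lintegral_hardDistribution κ (g := fun w => ∑ e ∈ G.select r w, (w e : ℝ≥0∞))
      (hmeas.comp measurable_prodMk_left)]
    have hw : ∑ i : Fin n, (layerWeight κ i : ℝ≥0∞) ≤ 2 ^ κ := by
      have h1 : ∀ i : ℕ, (layerWeight κ i : ℝ≥0∞) = ((if i < κ then 2 ^ i else 0 : ℕ) : ℝ≥0∞) := by
        intro i
        unfold layerWeight
        split_ifs <;> simp
      simp_rw [h1]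
      rw [← Nat.cast_sum, Fin.sum_univ_eq_sum_range (fun i => if i < κ then 2 ^ i else 0) n,
        ← Finset.sum_filter]
      have h2 : ∑ i ∈ Finset.range n with i < κ, 2 ^ i ≤ ∑ i ∈ Finset.range κ, 2 ^ i :=
        Finset.sum_le_sum_of_subset fun i hi => Finset.mem_range.2 (Finset.mem_filter.1 hi).2
      have h3 : ∑ i ∈ Finset.range κ, 2 ^ i < 2 ^ κ := by
        simpa using Nat.geomSum_lt (n := κ) le_rfl fun k hk => Finset.mem_range.1 hk
      exact_mod_cast h2.trans h3.le
    calc ∑' L : ℕ, (2⁻¹ : ℝ≥0∞) ^ (L + 1) * ∫⁻ ω, ∑ e ∈ G.select r (stoppedWeight κ L ω),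
            (stoppedWeight κ L ω e : ℝ≥0∞) ∂layersLaw n μ ν
        = ∫⁻ ω, ∑' L : ℕ, (2⁻¹ : ℝ≥0∞) ^ (L + 1) * ∑ e ∈ G.select r (stoppedWeight κ L ω),
            (stoppedWeight κ L ω e : ℝ≥0∞) ∂layersLaw n μ ν := by
          -- Averaging over `L` must come inside, with `ω` held fixed, for the coupling to apply.
          rw [lintegral_tsum fun L => Measurable.of_discrete.aemeasurable]
          exact tsum_congr fun L => (lintegral_const_mul _ Measurable.of_discrete).symm
      _ ≤ ∫⁻ ω, (Module.finrank (ZMod 2) V +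
            ∑ i : Fin n, (layerWeight κ i : ℝ≥0∞) * supportRank (ω i).2) ∂layersLaw n μ ν :=
          lintegral_mono fun ω => tsum_reward_stoppedWeight_le G hmono r κ ω
      _ = Module.finrank (ZMod 2) V +
            ∑ i : Fin n, (layerWeight κ i : ℝ≥0∞) * ∫⁻ x, (supportRank x : ℝ≥0∞) ∂ν := by
          rw [lintegral_add_left measurable_const, lintegral_const, measure_univ, mul_one,
            lintegral_finsetSum _ fun i _ => Measurable.of_discrete]
          congr 1
          refine Finset.sum_congr rfl fun i _ => ?_
          rw [lintegral_const_mul _ Measurable.of_discrete,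
            (measurePreserving_layer_snd i).lintegral_comp
              (f := fun x : V → Bool => (supportRank x : ℝ≥0∞)) Measurable.of_discrete]
      _ ≤ _ := by
          rw [← Finset.sum_mul]
          gcongr
  refine (lintegral_mono hr).trans ?_
  rw [lintegral_const, measure_univ, mul_one]

end Gambler

/-! ### Choice of parameters and conclusion -/

theorem exists_layered_arrival (V : Type) [Fintype V] (n : ℕ) :
    ∃ arrival : V × Fin n ≃ Fin (Fintype.card (V × Fin n)),
      ∀ e f : V × Fin n, arrival f ≤ arrival e → f.2 ≤ e.2 := by
  let σ := (Equiv.prodComm V (Fin n)).trans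
    (((Equiv.refl (Fin n)).prodCongr (Fintype.equivFin V)).trans finProdFinEquiv)
  have hcard : n * Fintype.card V = Fintype.card (V × Fin n) := by
    rw [Fintype.card_prod, Fintype.card_fin, mul_comm]
  refine ⟨σ.trans (finCongr hcard), fun e f h => ?_⟩
  have h' : (Fintype.equivFin V f.1 : ℕ) + Fintype.card V * f.2 ≤
      (Fintype.equivFin V e.1 : ℕ) + Fintype.card V * e.2 := h
  have he := (Fintype.equivFin V e.1).2
  by_contra hlt
  have hlt' : (e.2 : ℕ) + 1 ≤ f.2 := not_le.1 hlt
  nlinarith [Nat.mul_le_mul_left (Fintype.card V) hlt']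

theorem four_mul_add_five_le_two_pow {κ : ℕ} (hκ : 4 ≤ κ) : 4 * κ + 5 ≤ 2 * 2 ^ κ := by
  induction κ, hκ using Nat.le_induction with
  | base => norm_num
  | succ m hm ih =>
    rw [pow_succ]
    omega

theorem le_sum_div_two_pow (κ : ℕ) : κ ≤ ∑ l ∈ Finset.Icc 1 κ, 2 ^ (2 * κ) / 2 ^ l := by
  calc κ = ∑ _l ∈ Finset.Icc 1 κ, 1 := by simp
    _ ≤ _ := by
      refine Finset.sum_le_sum fun l hl => ?_
      rw [Nat.one_le_div_iff (by positivity)]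
      exact Nat.pow_le_pow_right (by norm_num) (by have := (Finset.mem_Icc.1 hl).2; omega)

/-- The constant `32` arises from `16 / κ` and `log d = 2 * κ * log 2 ≤ 2 * κ`. -/
theorem div_log_mul_ge {κ d : ℕ} (hκ : 4 ≤ κ) (hd : d = 2 ^ (2 * κ)) {P : ℝ≥0∞}
    (hP : (κ : ℝ≥0∞) * (2⁻¹ * (d * 2⁻¹)) ≤ P) :
    (4 * d : ℝ≥0∞) ≤ ENNReal.ofReal (32 / Real.log d) * P := by
  have hκ0 : (0 : ℝ) < κ := by
    have : 0 < κ := by omega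
    exact_mod_cast this
  have hlog : Real.log d = 2 * κ * Real.log 2 := by
    rw [hd]
    push_cast
    rw [Real.log_pow]
    push_cast
    ring
  have hlog2 : 0 < Real.log 2 := Real.log_pos (by norm_num)
  have hle : 16 / (κ : ℝ) ≤ 32 / Real.log d := by
    rw [hlog, div_le_div_iff₀ hκ0 (by positivity)]
    nlinarith [Real.log_two_lt_d9]
  have h2 : (2 : ℝ≥0∞)⁻¹ = ENNReal.ofReal 2⁻¹ := by
    rw [ENNReal.ofReal_inv_of_pos (by norm_num)]
    simp
  calc (4 * d : ℝ≥0∞) = ENNReal.ofReal (16 / κ) * (κ * (2⁻¹ * (d * 2⁻¹))) := by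
        rw [h2, ← ENNReal.ofReal_natCast κ, ← ENNReal.ofReal_natCast d,
          ← ENNReal.ofReal_mul (by positivity), ← ENNReal.ofReal_mul (by positivity),
          ← ENNReal.ofReal_mul (by positivity), ← ENNReal.ofReal_mul (by positivity),
          show (4 : ℝ≥0∞) = ENNReal.ofReal 4 by simp, ← ENNReal.ofReal_mul (by norm_num)]
        congr 1
        field_simp
        ring
    _ ≤ _ := by gcongr

theorem exists_hard_instance {κ d n : ℕ} (hκ : 4 ≤ κ) (hd : d = 2 ^ (2 * κ))
    (hn : n = ∑ l ∈ Finset.Icc 1 κ, d / 2 ^ l) :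
    ∃ (D : Measure ((Fin (2 * d) → ZMod 2) × Fin n → ℝ≥0))
      (arrival : (Fin (2 * d) → ZMod 2) × Fin n ≃
        Fin (Fintype.card ((Fin (2 * d) → ZMod 2) × Fin n))),
      IsPairwiseIndependent D ∧
      0 < prophetValue (parallelCopies (fullBinaryMatroid (2 * d)) n) D ∧
      prophetValue (parallelCopies (fullBinaryMatroid (2 * d)) n) D < ∞ ∧
      ∀ G : Gambler (parallelCopies (fullBinaryMatroid (2 * d)) n) arrival,
        G.value D ≤ ENNReal.ofReal (32 / Real.log d) *
          prophetValue (parallelCopies (fullBinaryMatroid (2 * d)) n) D := by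
  have hκn : κ ≤ n := by
    rw [hn, hd]
    exact le_sum_div_two_pow κ
  have hpow := four_mul_add_five_le_two_pow hκ
  have hd2 : d = 2 ^ κ * 2 ^ κ := by rw [hd, two_mul, pow_add]
  have hpos : 1 ≤ 2 ^ κ := Nat.one_le_two_pow
  have hd1 : 1 ≤ d := by
    rw [hd]
    exact Nat.one_le_two_pow
  have hjN : 4 * κ + 3 ≤ 2 * d := by
    rw [hd2]
    nlinarith
  have hj : 2 ^ (4 * κ + 3) = 8 * d ^ 2 := by
    rw [hd]
    ring
  have hV : Module.finrank (ZMod 2) (Fin (2 * d) → ZMod 2) = 2 * d := by simp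
  have hp : (2 : ℝ≥0∞) ^ (4 * κ + 3) / 2 ^ (2 * d) ≤ 1 :=
    ENNReal.div_le_of_le_mul (by rw [one_mul]; exact pow_le_pow_right₀ (by norm_num) hjN)
  have hμ := isPairwiseRandomSet_independentSet (V := Fin (2 * d) → ZMod 2) hp
  have hμr := le_lintegral_supportRank_independentSet hV hj hjN rfl hd1
  obtain ⟨ν, hν, hνr⟩ := exists_lowRank_pairwiseRandomSet hV (by omega) hjN
  set μ := independentSet (Fin (2 * d) → ZMod 2) (2 ^ (4 * κ + 3) / 2 ^ (2 * d))
  have := hμ.isProbabilityMeasure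
  have := hν.isProbabilityMeasure
  obtain ⟨arrival, hmono⟩ := exists_layered_arrival (Fin (2 * d) → ZMod 2) n
  have hD := isPairwiseIndependent_hardDistribution (n := n) κ hμ hν
  have := hD.isProbabilityMeasure
  have hP : (κ : ℝ≥0∞) * (2⁻¹ * (d * 2⁻¹)) ≤
      prophetValue (parallelCopies (fullBinaryMatroid (2 * d)) n)
        (hardDistribution n κ μ ν) :=
    le_trans (by gcongr) (le_prophetValue_hardDistribution (μ := μ) (ν := ν) hκn)
  refine ⟨hardDistribution n κ μ ν, arrival, hD, ?_,
    prophetValue_hardDistribution_lt_top _ κ, fun G => ?_⟩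
  · refine lt_of_lt_of_le ?_ hP
    have h1 : (κ : ℝ≥0∞) ≠ 0 := by
      have : κ ≠ 0 := by omega
      exact_mod_cast this
    have h2 : (d : ℝ≥0∞) ≠ 0 := by
      have : d ≠ 0 := by omega
      exact_mod_cast this
    simp only [pos_iff_ne_zero, ne_eq, mul_eq_zero, h1, h2, false_or]
    simp
  · refine le_trans ?_ (div_log_mul_ge hκ hd hP)
    calc G.value (hardDistribution n κ μ ν)
        ≤ (2 * d : ℕ) + 2 ^ κ * ((4 * κ + 3 : ℕ) + 2) := by
          refine (gambler_value_hardDistribution_le κ G hmono).trans ?_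
          rw [hV]
          gcongr
      _ ≤ 4 * d := by
          -- As `d = 2 ^ κ * 2 ^ κ`, the bound `4 * κ + 5 ≤ 2 * 2 ^ κ` makes the late reward at most
          -- `2 * d`.
          have h : 2 * d + 2 ^ κ * (4 * κ + 3 + 2) ≤ 4 * d := by
            rw [hd2]
            nlinarith
          exact_mod_cast h

theorem le_of_isCompetitive {E : Type} [Fintype E] {M : Matroid E} {α β : ℝ} (hβ : 0 ≤ β)
    {D : Measure (E → ℝ≥0)} {arrival : E ≃ Fin (Fintype.card E)}
    (hD : IsPairwiseIndependent D) (hpos : 0 < prophetValue M D) (hfin : prophetValue M D < ∞)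
    (hG : ∀ G : Gambler M arrival, G.value D ≤ ENNReal.ofReal β * prophetValue M D)
    (hα : IsCompetitive M α) : α ≤ β := by
  obtain ⟨G, h⟩ := hα D hD hfin.ne arrival
  have h2 := h.trans (hG G)
  rw [ENNReal.mul_le_mul_iff_left hpos.ne' hfin.ne] at h2
  exact (ENNReal.ofReal_le_ofReal_iff hβ).1 h2

theorem le_of_isCompetitive_parallelCopies {κ d n : ℕ} (hκ : 4 ≤ κ) (hd : d = 2 ^ (2 * κ))
    (hn : n = ∑ l ∈ Finset.Icc 1 κ, d / 2 ^ l) {α : ℝ}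
    (hα : IsCompetitive (parallelCopies (fullBinaryMatroid (2 * d)) n) α) :
    α ≤ 32 / Real.log d := by
  obtain ⟨D, arrival, hD, hpos, hfin, hG⟩ := exists_hard_instance hκ hd hn
  exact le_of_isCompetitive (div_nonneg (by norm_num) (Real.log_natCast_nonneg d))
    hD hpos hfin hG hα

theorem not_exists_isCompetitive_rank :
    ¬ ∃ α : ℕ → ℝ,
      Tendsto (fun r : ℕ => α r * Real.log r) atTop atTop ∧
      ∀ (E : Type) [Fintype E] (M : Matroid E) (r : ℕ),
        M.E = Set.univ → M.eRank = r → IsCompetitive M (α r) := by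
  rintro ⟨α, hα, hcomp⟩
  -- The rank is `2 * d`, while the bound involves `log d`. Since `log (2 * d) = log 2 + log d` and
  -- `log 2 ≤ log d`, doubling the constant `32` absorbs the difference.
  obtain ⟨r₀, hr₀⟩ := eventually_atTop.1 (hα.eventually_gt_atTop 64)
  let κ := max 4 r₀
  let d := 2 ^ (2 * κ)
  have hκ : 4 ≤ κ := le_max_left _ _
  have hκd : 2 * κ < d := Nat.lt_two_pow_self
  let n := ∑ l ∈ Finset.Icc 1 κ, d / 2 ^ l
  have hn : κ ≤ n := le_sum_div_two_pow κ
  have hrank : (parallelCopies (fullBinaryMatroid (2 * d)) n).eRank = (2 * d : ℕ) := by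
    refine (eRank_parallelCopies_fullLinearMatroid (by omega)).trans ?_
    simp
  have hle := le_of_isCompetitive_parallelCopies hκ rfl rfl
    (hcomp _ (parallelCopies (fullBinaryMatroid (2 * d)) n) (2 * d) rfl hrank)
  have hgt := hr₀ (2 * d) (by have : r₀ ≤ κ := le_max_right _ _; omega)
  have hd2 : (2 : ℝ) ≤ d := by
    have : 2 ≤ d := by omega
    exact_mod_cast this
  have hlogd : 0 < Real.log d := Real.log_pos (by linarith)
  have hlog2 : Real.log 2 ≤ Real.log d := Real.log_le_log (by norm_num) hd2
  have hlog : Real.log (2 * d : ℕ) = Real.log 2 + Real.log d := by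
    push_cast
    exact Real.log_mul (by norm_num) (by linarith)
  rw [hlog] at hgt
  have hlogpos : 0 < Real.log 2 := Real.log_pos (by norm_num)
  rw [le_div_iff₀ hlogd] at hle
  have h3 : α (2 * d) * Real.log 2 ≤ 32 := by
    rcases le_or_gt (α (2 * d)) 0 with h | h
    · nlinarith
    · nlinarith
  linarith

theorem mainTheorem1 :
    (∃ C : ℝ, 0 < C ∧
      ∀ κ d n : ℕ, 4 ≤ κ → d = 2 ^ (2 * κ) → n = ∑ l ∈ Finset.Icc 1 κ, d / 2 ^ l →
        (∃ (D : Measure ((Fin (2 * d) → ZMod 2) × Fin n → ℝ≥0))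
            (arrival : (Fin (2 * d) → ZMod 2) × Fin n ≃
              Fin (Fintype.card ((Fin (2 * d) → ZMod 2) × Fin n))),
          IsPairwiseIndependent D ∧
          0 < prophetValue (parallelCopies (fullBinaryMatroid (2 * d)) n) D ∧
          prophetValue (parallelCopies (fullBinaryMatroid (2 * d)) n) D < ∞ ∧
          ∀ G : Gambler (parallelCopies (fullBinaryMatroid (2 * d)) n) arrival,
            G.value D ≤ ENNReal.ofReal (C / Real.log d) *
              prophetValue (parallelCopies (fullBinaryMatroid (2 * d)) n) D) ∧
        (∀ α : ℝ, IsCompetitive (parallelCopies (fullBinaryMatroid (2 * d)) n) α →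
          α ≤ C / Real.log d)) ∧
    (¬ ∃ α : ℕ → ℝ,
      Tendsto (fun r : ℕ => α r * Real.log r) atTop atTop ∧
      ∀ (E : Type) [Fintype E] (M : Matroid E) (r : ℕ),
        M.E = Set.univ → M.eRank = r → IsCompetitive M (α r)) := by
  exact ⟨⟨32, by norm_num, fun κ d n hκ hd hn => ⟨exists_hard_instance hκ hd hn,
    fun α hα => le_of_isCompetitive_parallelCopies hκ hd hn hα⟩⟩, not_exists_isCompetitive_rank⟩
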